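/- Let $f$ be a free mapping of $\mathbb{R}^2$, that is, an orientation preserving homeomorphism $f:\mathbb{R}^2\to\mathbb{R}^2$ without fixed points, and let $\langle f\rangle$ be the cyclic group generated by $f$ in the group of all homeomorphisms of $\mathbb{R}^2$ under composition. Then the natural action of $\langle f\rangle$ on $\mathbb{R}^2$ is a covering space action: every $x\in\mathbb{R}^2$ has a neighborhood $U$ such that $g(U)\cap U=\emptyset$ for all $g\in\langle f\rangle$ with $g\neq \mathrm{Id}$. -/

import Mathlib

open scoped Topology Pointwise

/-- The Euclidean plane `ℝ²`. -/
abbrev Plane : Type := EuclideanSpace ℝ (Fin 2)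

/-- The unit vector `(cos t, sin t)`. -/
noncomputable def unitVec (t : ℝ) : Plane := !₂[Real.cos t, Real.sin t]

/-- The loop `γ` (a continuous `2π`-periodic map `ℝ → ℝ²`) misses `p` and has winding number `n`
about `p`: there is a continuous choice `φ` of the angle of `γ - p`, and this angle
increases by `2πn` over one period. -/
def HasWindingNumber (γ : ℝ → Plane) (p : Plane) (n : ℤ) : Prop :=
  (∀ t, γ t ≠ p) ∧
    ∃ φ : ℝ → ℝ, Continuous φ ∧ (∀ t, γ t - p = ‖γ t - p‖ • unitVec (φ t)) ∧
      φ (2 * Real.pi) = φ 0 + 2 * Real.pi * n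

/-- A homeomorphism `f` of the plane preserves orientation if it has local degree `+1` at every
point `x`: the image under `f` of every positively oriented circle centred at `x` winds exactly
once, in the positive direction, around `f x`. -/
def IsOrientationPreserving (f : Plane ≃ₜ Plane) : Prop :=
  ∀ (x : Plane) (r : ℝ), 0 < r → HasWindingNumber (fun t => f (x + r • unitVec t)) (f x) 1

/-- A free mapping of the plane: an orientation preserving homeomorphism without fixed points. -/
structure IsFreeMapping (f : Plane ≃ₜ Plane) : Prop where
  orientationPreserving : IsOrientationPreserving f
  fixedPointFree : ∀ x, f x ≠ x

/-- The group of self-homeomorphisms of `X` (under composition) acts on `X` by evaluation.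
Every subgroup inherits this action. -/
instance homeoMulAction (X : Type*) [TopologicalSpace X] : MulAction (X ≃ₜ X) X where
  smul g x := g x
  one_smul _ := rfl
  mul_smul _ _ _ := rfl

/-- A covering space action of a group `G` on a topological space `X`: `G` acts by continuous maps
(hence by homeomorphisms), and every point of `X` has a neighbourhood `U` such that `g(U)` is
disjoint from `U` for every `g ≠ 1` in `G`. -/
structure IsCoveringSpaceAction (G X : Type*) [Group G] [TopologicalSpace X] [MulAction G X] :
    Prop where
  continuous_smul : ∀ g : G, Continuous fun x : X => g • x
  exists_nhds_disjoint : ∀ x : X, ∃ U ∈ 𝓝 x, ∀ g : G, g ≠ 1 → Disjoint (g • U) U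

/-! This is Brouwer's argument: a free homeomorphism has no periodic points, and hence a free disc
never meets its iterates. Orientation enters as a continuous logarithm `L` of (F z - F w)/(z - w) on
pairs z ≠ w, a property stable under composition. A 2-cycle is excluded by comparing `L` with a
logarithm of F z - z (`IsFreeHomeo.apply_apply_ne`). For n ≥ 3, three pushes supported in free sets
turn an n-cycle into an (n-1)-cycle of another free homeomorphism
(`IsFreeHomeo.exists_shorter_period`), so the induction runs over all free homeomorphisms at once.
If a free connected open set met an iterate of itself, pushing a first return back to its start
would create a periodic point (`IsFreeHomeo.iterate_notMem`). -/

/-! ### Continuous logarithms and orientation -/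

open Complex in
/-- A nowhere vanishing continuous function on a simply connected space has a continuous
logarithm. -/
theorem exists_continuous_exp_eq {A : Type*} [TopologicalSpace A] [SimplyConnectedSpace A]
    [LocallyPathConnectedSpace A] (q : A → ℂ) (hq : Continuous q) (h0 : ∀ a, q a ≠ 0) :
    ∃ L : A → ℂ, Continuous L ∧ ∀ a, exp (L a) = q a := by
  obtain ⟨a₀⟩ : Nonempty A := inferInstance
  obtain ⟨G, ⟨-, hG⟩, -⟩ := Complex.isCoveringMap_exp.existsUnique_continuousMap_lifts
    (⟨fun a => ⟨q a, h0 a⟩, by fun_prop⟩ : C(A, {z : ℂ // z ≠ 0})) a₀ (log (q a₀))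
    (Subtype.ext (exp_log (h0 a₀)))
  exact ⟨G, G.continuous, fun a => congrArg Subtype.val (congrFun hG a)⟩

/-- A continuous function with values in the kernel of the exponential is constant. -/
theorem eq_of_continuous_of_exp_eq_one {X : Type*} [TopologicalSpace X] [PreconnectedSpace X]
    {g : X → ℂ} (hg : Continuous g) (h1 : ∀ x, Complex.exp (g x) = 1) (x y : X) : g x = g y := by
  choose n hn using fun x => Complex.exp_eq_one_iff.1 (h1 x)
  have hpi := Real.pi_ne_zero
  have hre : ∀ x, ((n x : ℤ) : ℝ) = (g x).im / (2 * Real.pi) := by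
    intro x
    rw [hn x]
    simp
  have hc : Continuous n := by
    rw [Int.isClosedEmbedding_coe_real.isInducing.continuous_iff]
    have : ((fun m : ℤ => (m : ℝ)) ∘ n) = fun x => (g x).im / (2 * Real.pi) := funext hre
    rw [this]
    fun_prop
  rw [hn x, hn y, PreconnectedSpace.constant ‹_› hc]

/-- The quotient `(F z - F w) / (z - w)` has a continuous logarithm on the space of pairs of
distinct points. -/
def HasLogDisplacement (F : ℂ → ℂ) : Prop :=
  ∃ L : ℂ × ℂ → ℂ, ContinuousOn L {p | p.1 ≠ p.2} ∧
    ∀ z w, z ≠ w → F z - F w = Complex.exp (L (z, w)) * (z - w)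

theorem HasLogDisplacement.comp {F G : ℂ → ℂ} (hG : HasLogDisplacement G)
    (hF : HasLogDisplacement F) (hc : Continuous F) (hi : Function.Injective F) :
    HasLogDisplacement (G ∘ F) := by
  obtain ⟨K, hK, hK'⟩ := hG
  obtain ⟨L, hL, hL'⟩ := hF
  refine ⟨fun p => K (F p.1, F p.2) + L p, ?_, fun z w hzw => ?_⟩
  · refine ContinuousOn.add (hK.comp (by fun_prop) ?_) hL
    exact fun p hp => hi.ne hp
  · rw [Function.comp_apply, Function.comp_apply, hK' _ _ (hi.ne hzw), hL' _ _ hzw,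
      Complex.exp_add, mul_assoc]

open Complex in
/-- A function of a point and a logarithm which is periodic in the logarithm descends to a
continuous function of pairs of distinct points. -/
theorem continuousOn_comp_log_sub {L : ℂ × ℂ → ℂ} (hL : Continuous L)
    (hper : ∀ w s, L (w, s + 2 * Real.pi * I) = L (w, s)) :
    ContinuousOn (fun p : ℂ × ℂ => L (p.2, log (p.1 - p.2))) {p | p.1 ≠ p.2} := by
  have hper' : ∀ w s s', exp s = exp s' → L (w, s) = L (w, s') := by
    intro w s s' h
    obtain ⟨n, hn⟩ := exp_eq_exp_iff_exists_int.1 h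
    have hp : Function.Periodic (fun s => L (w, s)) (2 * Real.pi * I) := hper w
    rw [hn]
    exact hp.int_mul n s'
  intro p hp
  apply ContinuousAt.continuousWithinAt
  have hne : p.1 - p.2 ≠ 0 := sub_ne_zero.2 hp
  by_cases hs : p.1 - p.2 ∈ slitPlane
  · exact hL.continuousAt.comp (f := fun p : ℂ × ℂ => (p.2, log (p.1 - p.2)))
      (continuousAt_snd.prodMk ((continuousAt_fst.sub continuousAt_snd).clog hs))
  -- Across the cut, log(-v) + πi is another logarithm of v, and periodicity makes the choice
  -- irrelevant.
  · have hs' : -(p.1 - p.2) ∈ slitPlane := by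
      rw [mem_slitPlane_iff, not_or] at hs
      rw [mem_slitPlane_iff]
      left
      have h1 := hs.1
      have h2 := not_not.1 hs.2
      have h3 : (p.1 - p.2).re ≠ 0 := fun h => hne (Complex.ext h h2)
      rw [neg_re]
      have := lt_of_le_of_ne (not_lt.1 h1) h3
      linarith
    have hev : (fun p : ℂ × ℂ => L (p.2, log (-(p.1 - p.2)) + Real.pi * I)) =ᶠ[𝓝 p]
        fun p : ℂ × ℂ => L (p.2, log (p.1 - p.2)) := by
      have : ∀ᶠ x : ℂ × ℂ in 𝓝 p, x.1 - x.2 ≠ 0 :=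
        (continuousAt_fst.sub continuousAt_snd).eventually_ne hne
      filter_upwards [this] with x hx
      apply hper'
      rw [exp_add, exp_log (neg_ne_zero.2 hx), exp_log hx, exp_pi_mul_I]
      ring
    refine ContinuousAt.congr ?_ hev
    exact hL.continuousAt.comp (f := fun p : ℂ × ℂ => (p.2, log (-(p.1 - p.2)) + Real.pi * I))
      (continuousAt_snd.prodMk
        (((continuousAt_fst.sub continuousAt_snd).neg.clog hs').add continuousAt_const))

open Complex in
/-- A continuous injection under which the image of the unit circle winds once around the image of
its centre has a continuous logarithmic displacement. -/
theorem HasLogDisplacement.of_winding {F : ℂ → ℂ} (hF : Continuous F)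
    (hi : Function.Injective F) {φ : ℝ → ℝ} (hφ : Continuous φ)
    (h : ∀ t : ℝ, F (exp (t * I)) - F 0 = ‖F (exp (t * I)) - F 0‖ * exp (φ t * I))
    (h1 : φ (2 * Real.pi) = φ 0 + 2 * Real.pi) : HasLogDisplacement F := by
  have hne : ∀ w s, F (w + exp s) - F w ≠ 0 := fun w s =>
    sub_ne_zero.2 (hi.ne (by simp [exp_ne_zero]))
  obtain ⟨L, hL, hL'⟩ := exists_continuous_exp_eq
    (fun p : ℂ × ℂ => (F (p.1 + exp p.2) - F p.1) * exp (-p.2)) (by fun_prop)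
    (fun p => mul_ne_zero (hne _ _) (exp_ne_zero _))
  have hper : ∀ w s, L (w, s + 2 * Real.pi * I) = L (w, s) := by
    -- The jump of `L` over a period is constant, so the unit circle about 0 determines it: the
    -- angle of F gains 2π, which the factor exp(-s) cancels.
    have hc := eq_of_continuous_of_exp_eq_one
      (g := fun p : ℂ × ℂ => L (p.1, p.2 + 2 * Real.pi * I) - L p) (by fun_prop) (by
        intro p
        simp only [exp_sub, hL', exp_add, neg_add, exp_two_pi_mul_I, exp_neg]
        have := hne p.1 p.2
        field_simp)
    have hne' : ∀ t : ℝ, F (exp (t * I)) - F 0 ≠ 0 := fun t => by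
      simpa using hne 0 (t * I)
    have hn : Continuous fun t : ℝ => Real.log ‖F (exp (t * I)) - F 0‖ :=
      Continuous.log (by fun_prop) fun t => norm_ne_zero_iff.2 (hne' t)
    have hg := eq_of_continuous_of_exp_eq_one
      (g := fun t : ℝ => L (0, t * I) + t * I -
        (Real.log ‖F (exp (t * I)) - F 0‖ + φ t * I)) (by fun_prop) (by
        intro t
        rw [exp_sub, exp_add, hL', exp_add, ← ofReal_exp,
          Real.exp_log (norm_pos_iff.2 (hne' t)), ← h t, exp_neg]
        have := hne' t
        have := exp_ne_zero (t * I)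
        simp only [zero_add]
        field_simp) (2 * Real.pi) 0
    simp only [h1] at hg
    push_cast at hg
    simp only [exp_two_pi_mul_I, zero_mul, exp_zero] at hg
    have h0 : L (0, 2 * Real.pi * I) = L (0, 0) := by linear_combination hg
    intro w s
    have := hc (w, s) (0, 0)
    simp only [zero_add, h0, sub_self] at this
    exact sub_eq_zero.1 this
  refine ⟨_, continuousOn_comp_log_sub hL hper, fun z w hzw => ?_⟩
  have hzw' := sub_ne_zero.2 hzw
  rw [hL', exp_neg, exp_log hzw']
  field_simp
  simp

-- The pairs (w + exp s, w) exhaust the distinct pairs, so L(z, w) - L(w, z) is constant; being odd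
-- under the swap, it vanishes.
open Complex in
theorem logDisplacement_symm {F : ℂ → ℂ} {L : ℂ × ℂ → ℂ}
    (hL : ContinuousOn L {p | p.1 ≠ p.2})
    (hL' : ∀ z w, z ≠ w → F z - F w = exp (L (z, w)) * (z - w)) {z w : ℂ} (hzw : z ≠ w) :
    L (z, w) = L (w, z) := by
  have hne : ∀ w s : ℂ, w + exp s ≠ w := fun w s => by simp [exp_ne_zero]
  have hexp : ∀ z w, z ≠ w → exp (L (z, w)) = exp (L (w, z)) := by
    intro z w h
    have h1 := hL' z w h
    have h2 := hL' w z h.symm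
    have h3 := sub_ne_zero.2 h
    apply mul_right_cancel₀ h3
    linear_combination -h1 - h2
  have hc := eq_of_continuous_of_exp_eq_one
    (g := fun p : ℂ × ℂ => L (p.1 + exp p.2, p.1) - L (p.1, p.1 + exp p.2))
    ((hL.comp_continuous (by fun_prop) fun p => hne _ _).sub
      (hL.comp_continuous (by fun_prop) fun p => (hne _ _).symm))
    (fun p => by rw [exp_sub, hexp _ _ (hne _ _), div_self (exp_ne_zero _)])
    (w, log (z - w)) (z, log (w - z))
  simp only [exp_log (sub_ne_zero.2 hzw), exp_log (sub_ne_zero.2 hzw.symm),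
    add_sub_cancel] at hc
  linear_combination hc / 2

/-! ### Excluding 2-cycles -/

/-- A homeomorphism of the plane which preserves orientation and has no fixed point. -/
structure IsFreeHomeo (F : ℂ ≃ₜ ℂ) : Prop where
  log : HasLogDisplacement F
  ne : ∀ z, F z ≠ z

-- θ(F z) - θ(z) - L(F z, z) is constant. On a 2-cycle the symmetry of `L` then forces θ(F x) =
-- θ(x), whereas the displacements at x and F x are opposite.
open Complex in
theorem IsFreeHomeo.apply_apply_ne {F : ℂ ≃ₜ ℂ} (hF : IsFreeHomeo F) (x : ℂ) : F (F x) ≠ x := by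
  intro hx
  obtain ⟨L, hL, hL'⟩ := hF.log
  obtain ⟨θ, hθ, hθ'⟩ := exists_continuous_exp_eq (fun z => F z - z) (by fun_prop)
    (fun z => sub_ne_zero.2 (hF.ne z))
  have hc := eq_of_continuous_of_exp_eq_one (g := fun z => θ (F z) - θ z - L (F z, z))
    (((hθ.comp F.continuous).sub hθ).sub
      (hL.comp_continuous (by fun_prop) fun z => hF.ne z)) (by
      intro z
      have h1 := hL' _ _ (hF.ne z)
      have h2 := sub_ne_zero.2 (hF.ne z)
      have h3 := exp_ne_zero (L (F z, z))
      rw [exp_sub, exp_sub, hθ', hθ', h1]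
      field_simp) x (F x)
  simp only [hx] at hc
  rw [logDisplacement_symm hL hL' (hF.ne x).symm] at hc
  have h2 : θ (F x) = θ x := by linear_combination hc / 2
  have h3 := hθ' (F x)
  rw [h2, hθ', hx] at h3
  apply hF.ne x
  linear_combination h3 / 2

/-! ### Pushing points inside open sets -/

-- The difference quotient stays in a disc of radius less than 1 about 1, where the principal
-- logarithm is continuous.
open Complex in
theorem HasLogDisplacement.of_norm_sub_le {h : ℂ → ℂ} (hc : Continuous h) {c : ℝ} (hc1 : c < 1)
    (hh : ∀ z w, ‖h z - h w - (z - w)‖ ≤ c * ‖z - w‖) : HasLogDisplacement h := by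
  have key : ∀ z w, z ≠ w → (h z - h w) / (z - w) ∈ slitPlane := by
    intro z w hzw
    have h0 := sub_ne_zero.2 hzw
    have h1 := norm_pos_iff.2 h0
    have h2 : (h z - h w) / (z - w) = 1 + (h z - h w - (z - w)) / (z - w) := by
      field_simp
      ring
    rw [h2]
    apply mem_slitPlane_of_norm_lt_one
    rw [norm_div, div_lt_one h1]
    nlinarith [hh z w]
  refine ⟨fun p => Complex.log ((h p.1 - h p.2) / (p.1 - p.2)), ?_, fun z w hzw => ?_⟩
  · refine ContinuousOn.clog (ContinuousOn.div (by fun_prop) (by fun_prop) ?_) ?_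
    · exact fun p hp => sub_ne_zero.2 hp
    · exact fun p hp => key _ _ hp
  · have h0 := sub_ne_zero.2 hzw
    rw [exp_log (slitPlane_ne_zero (key z w hzw))]
    field_simp

/-- There is a homeomorphism with logarithmic displacement, supported in `V`, which moves `a` to
`b`. -/
def CanPush (V : Set ℂ) (a b : ℂ) : Prop :=
  ∃ h : ℂ ≃ₜ ℂ, HasLogDisplacement h ∧ (∀ z ∉ V, h z = z) ∧ h a = b

theorem CanPush.trans {V : Set ℂ} {a b c : ℂ} (h₁ : CanPush V a b) (h₂ : CanPush V b c) :
    CanPush V a c := by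
  obtain ⟨h, hl, hs, hab⟩ := h₁
  obtain ⟨k, kl, ks, kbc⟩ := h₂
  refine ⟨h.trans k, kl.comp hl h.continuous h.injective, fun z hz => ?_, ?_⟩
  · rw [Homeomorph.trans_apply, hs z hz, ks z hz]
  · rw [Homeomorph.trans_apply, hab, kbc]

-- Adding to the identity b - a times a tent function of slope 1/r gives a perturbation with
-- Lipschitz constant ‖b - a‖/r < 1, hence a homeomorphism.
open scoped NNReal in
theorem canPush_of_ball_subset {V : Set ℂ} {a b : ℂ} {r : ℝ} (hV : Metric.ball a r ⊆ V)
    (hb : ‖b - a‖ < r) : CanPush V a b := by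
  have hr : 0 < r := (norm_nonneg _).trans_lt hb
  set m : ℂ → ℝ := fun z => max 0 (1 - ‖z - a‖ / r) with hm
  set f : ℂ → ℂ := fun z => z + m z • (b - a) with hf
  have hmLip : ∀ z w, |m z - m w| ≤ ‖z - w‖ / r := by
    intro z w
    have h1 := abs_max_sub_max_le_abs (1 - ‖z - a‖ / r) (1 - ‖w - a‖ / r) 0
    rw [max_comm _ 0, max_comm _ 0] at h1
    refine h1.trans ?_
    have h2 : 1 - ‖z - a‖ / r - (1 - ‖w - a‖ / r) = (‖w - a‖ - ‖z - a‖) / r := by ring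
    rw [h2, abs_div, abs_of_pos hr]
    gcongr
    have h3 := abs_norm_sub_norm_le (w - a) (z - a)
    rwa [sub_sub_sub_cancel_right, norm_sub_rev w z] at h3
  set c : ℝ≥0 := ⟨‖b - a‖ / r, by positivity⟩ with hc
  have hcr : (c : ℝ) = ‖b - a‖ / r := rfl
  have hc1 : (c : ℝ) < 1 := by rw [hcr, div_lt_one hr]; exact hb
  have hbound : ∀ z w, ‖f z - f w - (z - w)‖ ≤ c * ‖z - w‖ := by
    intro z w
    have h1 : f z - f w - (z - w) = (m z - m w) • (b - a) := by
      simp only [hf, sub_smul]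
      ring
    rw [h1, norm_smul, Real.norm_eq_abs, hcr]
    calc |m z - m w| * ‖b - a‖ ≤ ‖z - w‖ / r * ‖b - a‖ := by gcongr; exact hmLip z w
      _ = ‖b - a‖ / r * ‖z - w‖ := by ring
  have happ : ApproximatesLinearOn f (ContinuousLinearEquiv.refl ℝ ℂ : ℂ →L[ℝ] ℂ) Set.univ c :=
    fun z _ w _ => hbound z w
  have hN : ‖((ContinuousLinearEquiv.refl ℝ ℂ).symm : ℂ →L[ℝ] ℂ)‖₊ = 1 := by
    ext
    exact ContinuousLinearMap.norm_id
  have hfc : Continuous f := by simp only [hf, hm]; fun_prop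
  refine ⟨happ.toHomeomorph f (Or.inr (by rw [hN, inv_one]; exact_mod_cast hc1)), ?_, ?_, ?_⟩
  · exact HasLogDisplacement.of_norm_sub_le hfc hc1 hbound
  · intro z hz
    change f z = z
    have : r ≤ ‖z - a‖ := by
      by_contra hlt
      exact hz (hV (by rw [mem_ball_iff_norm]; exact not_le.1 hlt))
    have h2 : m z = 0 := by
      apply max_eq_left
      rw [sub_nonpos, one_le_div hr]
      exact this
    simp [hf, h2]
  · change f a = b
    simp [hf, hm]

/-- In a connected open set every point can be pushed to every other one. -/
theorem canPush_of_isPreconnected {V : Set ℂ} (hV : IsOpen V) (hc : IsPreconnected V) {a b : ℂ}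
    (ha : a ∈ V) (hb : b ∈ V) : CanPush V a b := by
  refine hc.induction₂' (CanPush V) (fun x hx => ?_) (fun _ _ _ _ _ _ => CanPush.trans) ha hb
  obtain ⟨r, hr, hrV⟩ := Metric.isOpen_iff.1 hV x hx
  refine mem_nhdsWithin_of_mem_nhds ?_
  filter_upwards [Metric.ball_mem_nhds x (half_pos hr)] with y hy
  rw [mem_ball_iff_norm] at hy
  refine ⟨canPush_of_ball_subset hrV (by linarith),
    canPush_of_ball_subset (r := r / 2) (fun z hz => hrV ?_) (by rwa [norm_sub_rev])⟩
  rw [mem_ball_iff_norm] at hz ⊢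
  have := norm_add_le (z - y) (y - x)
  rw [sub_add_sub_cancel] at this
  linarith

theorem apply_mem_of_eq_self_outside {h : ℂ ≃ₜ ℂ} {V : Set ℂ} (hs : ∀ z ∉ V, h z = z) {z : ℂ}
    (hz : z ∈ V) : h z ∈ V := by
  by_contra hn
  exact hn ((h.injective (hs _ hn)).symm ▸ hz)

/-- Composing a free homeomorphism with a homeomorphism supported in a free set does not create
fixed points. -/
theorem IsFreeHomeo.trans {F h : ℂ ≃ₜ ℂ} (hF : IsFreeHomeo F) (hh : HasLogDisplacement h)
    {V : Set ℂ} (hs : ∀ z ∉ V, h z = z) (hV : ∀ z ∈ V, F z ∉ V) : IsFreeHomeo (F.trans h) where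
  log := hh.comp hF.log F.continuous F.injective
  ne z hz := by
    rw [Homeomorph.trans_apply] at hz
    by_cases hFz : F z ∈ V
    · exact hV z (hz ▸ apply_mem_of_eq_self_outside hs hFz) hFz
    · exact hF.ne z (hs _ hFz ▸ hz)

/-! ### Returning orbits -/

/-- No free homeomorphism has a point fixed by its `n`-th iterate. -/
def NoPeriod (n : ℕ) : Prop := ∀ F : ℂ ≃ₜ ℂ, IsFreeHomeo F → ∀ x, F^[n] x ≠ x

/-- A returning orbit of a free connected open set can be closed up to a periodic orbit. -/
theorem IsFreeHomeo.iterate_notMem {F : ℂ ≃ₜ ℂ} (hF : IsFreeHomeo F) {V : Set ℂ} (hV : IsOpen V)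
    (hc : IsPreconnected V) (hfree : ∀ z ∈ V, F z ∉ V) {n : ℕ}
    (hn : ∀ k, 0 < k → k < n → NoPeriod k) :
    ∀ k, 0 < k → k < n → ∀ z ∈ V, F^[k] z ∉ V := by
  intro k
  induction k using Nat.strong_induction_on with
  | _ k ih =>
    intro hk0 hkn y hy hky
    obtain ⟨h, hl, hs, hh⟩ := canPush_of_isPreconnected hV hc hky hy
    have horb : ∀ i < k, (F.trans h)^[i] y = F^[i] y := by
      intro i
      induction i with
      | zero => simp
      | succ i ihi =>
        intro hi
        rw [Function.iterate_succ_apply', ihi (by omega), Homeomorph.trans_apply,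
          ← Function.iterate_succ_apply' (f := F)]
        exact hs _ (ih (i + 1) hi (by omega) (by omega) y hy)
    -- Earlier iterates avoid V, so the push acts only at the last step and closes the orbit.
    refine hn k hk0 hkn _ (hF.trans hl hs hfree) y ?_
    obtain ⟨j, rfl⟩ : ∃ j, k = j + 1 := ⟨k - 1, by omega⟩
    rw [Function.iterate_succ_apply', horb j (by omega), Homeomorph.trans_apply,
      ← Function.iterate_succ_apply' (f := F), hh]

/-! ### Maximal free balls and shortening of cycles -/

/-- A largest free ball about `x` has a boundary point which is mapped into the boundary. -/
theorem IsFreeHomeo.exists_maximal_free_ball {F : ℂ ≃ₜ ℂ} (hF : IsFreeHomeo F) (x : ℂ) :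
    ∃ r > 0, ∃ z, (∀ u ∈ Metric.ball x r, F u ∉ Metric.ball x r) ∧
      z ∈ Metric.closedBall x r ∧ F z ∈ Metric.closedBall x r := by
  -- The minimum of this proper function is the critical radius, and a minimizer is the required
  -- point.
  obtain ⟨z, hz⟩ := Continuous.exists_forall_le (f := fun z => max (dist z x) (dist (F z) x))
    (by fun_prop) (Filter.tendsto_atTop_mono (fun z => le_max_left _ _)
      (tendsto_dist_right_cocompact_atTop x))
  refine ⟨max (dist z x) (dist (F z) x), ?_, z, fun u hu hu' => ?_,
    Metric.mem_closedBall.2 (le_max_left _ _), Metric.mem_closedBall.2 (le_max_right _ _)⟩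
  · by_contra hle
    rw [gt_iff_lt, not_lt, max_le_iff] at hle
    have h1 := dist_le_zero.1 hle.1
    have h2 := dist_le_zero.1 hle.2
    exact hF.ne z (h2.trans h1.symm)
  · exact absurd (hz u) (not_le.2 (max_lt hu hu'))

theorem segment_subset_insert_ball {x p : ℂ} {r : ℝ} (hr : 0 < r)
    (hp : p ∈ Metric.closedBall x r) : segment ℝ x p ⊆ insert p (Metric.ball x r) := by
  have h := (convex_ball x r).openSegment_interior_closure_subset_interior (x := x) (y := p)
    (by rw [Metric.isOpen_ball.interior_eq]; exact Metric.mem_ball_self hr)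
    (by rwa [closure_ball x hr.ne'])
  rw [Metric.isOpen_ball.interior_eq] at h
  rw [← insert_endpoints_openSegment]
  rintro y (rfl | rfl | hy)
  · exact Or.inr (Metric.mem_ball_self hr)
  · exact Or.inl rfl
  · exact Or.inr (h hy)

/-- A segment is contained in a convex open set disjoint from a neighbourhood of a given point
outside the segment. -/
theorem exists_convex_open_segment {x p q : ℂ} (hq : q ∉ segment ℝ x p) :
    ∃ O N : Set ℂ, IsOpen O ∧ Convex ℝ O ∧ x ∈ O ∧ p ∈ O ∧ IsOpen N ∧ q ∈ N ∧ Disjoint O N := by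
  have hK : IsCompact (segment ℝ x p) := by
    rw [segment_eq_image_lineMap]
    exact isCompact_Icc.image (by fun_prop)
  obtain ⟨δ, hδ, hd⟩ := (Set.disjoint_singleton_right.2 hq).exists_thickenings hK
    isClosed_singleton
  exact ⟨_, _, Metric.isOpen_thickening, (convex_segment x p).thickening δ,
    Metric.self_subset_thickening hδ _ (left_mem_segment ℝ x p),
    Metric.self_subset_thickening hδ _ (right_mem_segment ℝ x p),
    Metric.isOpen_thickening, Metric.self_subset_thickening hδ _ (Set.mem_singleton q), hd⟩

/-- Pushing the image of a point along three free sets skips one point of its orbit. -/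
theorem IsFreeHomeo.exists_skip {F : ℂ ≃ₜ ℂ} (hF : IsFreeHomeo F) {W B W' : Set ℂ} {x a b y : ℂ}
    (hW : IsOpen W) (hWc : IsPreconnected W) (hB : IsOpen B) (hBc : IsPreconnected B)
    (hW' : IsOpen W') (hWc' : IsPreconnected W')
    (hx : x ∈ W) (haW : a ∈ W) (haB : a ∈ B) (hbB : b ∈ B) (hbW' : b ∈ W') (hy : y ∈ W')
    (hFW : ∀ z ∈ W, F z ∉ W) (hFB : ∀ z ∈ B, F z ∉ B) (hFW' : ∀ z ∈ W', F z ∉ W')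
    (hBW : ∀ z ∈ B, F z ∉ W) (hWW' : ∀ z ∈ W', F z ∉ W) (hBW' : ∀ z ∈ W', F z ∉ B) :
    ∃ G : ℂ ≃ₜ ℂ, IsFreeHomeo G ∧ (∀ z, F z = x → G z = y) ∧
      ∀ z, F z ∉ W → F z ∉ B → F z ∉ W' → G z = F z := by
  obtain ⟨h₁, l₁, s₁, e₁⟩ := canPush_of_isPreconnected hW hWc hx haW
  obtain ⟨h₂, l₂, s₂, e₂⟩ := canPush_of_isPreconnected hB hBc haB hbB
  obtain ⟨h₃, l₃, s₃, e₃⟩ := canPush_of_isPreconnected hW' hWc' hbW' hy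
  -- Each new support is mapped by F off the earlier ones, so the earlier pushes do not spoil its
  -- freeness.
  have f₁ := hF.trans l₁ s₁ hFW
  have f₂ := f₁.trans l₂ s₂ (fun z hz => by
    rw [Homeomorph.trans_apply, s₁ _ (hBW z hz)]
    exact hFB z hz)
  have f₃ := f₂.trans l₃ s₃ (fun z hz => by
    rw [Homeomorph.trans_apply, Homeomorph.trans_apply, s₁ _ (hWW' z hz), s₂ _ (hBW' z hz)]
    exact hFW' z hz)
  refine ⟨_, f₃, fun z hz => ?_, fun z hz₁ hz₂ hz₃ => ?_⟩
  · simp only [Homeomorph.trans_apply, hz, e₁, e₂, e₃]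
  · simp only [Homeomorph.trans_apply, s₁ _ hz₁, s₂ _ hz₂, s₃ _ hz₃]

/-- The maximal free ball U and its image touch at F z. Pushing x towards F z within U, across a
small ball B, then to F x within F(U) sends F^(n-1) x directly to F x. -/
theorem IsFreeHomeo.exists_shorter_period {F : ℂ ≃ₜ ℂ} (hF : IsFreeHomeo F) {n : ℕ} (hn3 : 3 ≤ n)
    (hn : ∀ k, 0 < k → k < n → NoPeriod k) {x : ℂ} (hx : F^[n] x = x) : False := by
  obtain ⟨r, hr, z, hfree, hz, hp⟩ := hF.exists_maximal_free_ball x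
  set U := Metric.ball x r with hU
  have hUo : IsOpen U := Metric.isOpen_ball
  have hUc : Convex ℝ U := convex_ball x r
  have hxU : x ∈ U := Metric.mem_ball_self hr
  have hcl : closure U = Metric.closedBall x r := closure_ball x hr.ne'
  have hit := hF.iterate_notMem hUo hUc.isPreconnected hfree hn
  have hcont : ∀ k, Continuous F^[k] := fun k => F.continuous.iterate k
  have hopen : ∀ k, IsOpenMap F^[k] := by
    intro k
    induction k with
    | zero => exact IsOpenMap.id
    | succ k ih => rw [Function.iterate_succ]; exact ih.comp F.isOpenMap
  have hout : ∀ k, 0 < k → k < n → ∀ u ∈ U, F^[k] u ∉ closure U := by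
    intro k h0 h1 u hu hc
    obtain ⟨v, ⟨w, hw, rfl⟩, hv⟩ := mem_closure_iff.1 hc _ (hopen k U hUo) ⟨u, hu, rfl⟩
    exact hit k h0 h1 w hw hv
  have hin : ∀ k, 0 < k → k < n → ∀ u ∈ closure U, F^[k] u ∉ U := by
    intro k h0 h1 u hu hk
    obtain ⟨v, hv, hvU⟩ := mem_closure_iff.1 hu _ (hUo.preimage (hcont k)) hk
    exact hit k h0 h1 v hvU hv
  have hzc : z ∈ closure U := hcl ▸ hz
  have hpc : F z ∈ closure U := hcl ▸ hp
  have hpU : F z ∉ U := hin 1 one_pos (by omega) z hzc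
  have hzU : z ∉ U := fun h => hout 1 one_pos (by omega) z h hpc
  have hFp : F (F z) ∉ U := hin 2 two_pos (by omega) z hzc
  have hq : F.symm z ∉ U := fun h => by
    apply hout 2 two_pos (by omega) _ h
    simpa using hpc
  have hFps : F (F z) ∉ segment ℝ x (F z) := fun h =>
    (segment_subset_insert_ball hr hp h).elim (fun e => hF.ne _ e) hFp
  have hqs : F.symm z ∉ segment ℝ x z := fun h =>
    (segment_subset_insert_ball hr hz h).elim
      (fun e => hF.ne z (by nth_rw 1 [← e]; simp)) hq
  -- Trimming U to `O` and `O'` keeps F(B) off the first support and F²(U ∩ O') off B.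
  obtain ⟨O, N, hO, hOc, hxO, hpO, hN, hpN, hON⟩ := exists_convex_open_segment hFps
  obtain ⟨O', N', hO', hOc', hxO', hzO', hN', hqN', hON'⟩ := exists_convex_open_segment hqs
  -- a small ball about `F z`
  obtain ⟨P, Q, hP, hQ, hpP, hpQ, hPQ⟩ := t2_separation (hF.ne (F z))
  have hnhds : ∀ᶠ u in 𝓝 (F z), u ∈ Q ∧ F u ∈ P ∧ F u ∈ N ∧ F.symm (F.symm u) ∈ N' ∧
      ∀ i ∈ Finset.Ico 2 n, u ≠ F^[i] x := by
    have c1 : ContinuousAt F (F z) := F.continuous.continuousAt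
    have c2 : ContinuousAt (fun u => F.symm (F.symm u)) (F z) := by fun_prop
    have c3 : ∀ᶠ u in 𝓝 (F z), ∀ i ∈ Finset.Ico 2 n, u ≠ F^[i] x := by
      rw [Filter.eventually_all_finset]
      intro i hi
      rw [Finset.mem_Ico] at hi
      apply eventually_ne_nhds
      intro h
      exact hout i (by omega) hi.2 x hxU (h ▸ hpc)
    filter_upwards [hQ.mem_nhds hpQ, c1 (hP.mem_nhds hpP), c1 (hN.mem_nhds hpN),
      c2 (hN'.mem_nhds (by simpa using hqN')), c3] with u h1 h2 h3 h4 h5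
    exact ⟨h1, h2, h3, h4, h5⟩
  obtain ⟨ε, hε, hB⟩ := Metric.eventually_nhds_iff_ball.1 hnhds
  set B := Metric.ball (F z) ε
  have hpB : F z ∈ B := Metric.mem_ball_self hε
  obtain ⟨a, ⟨haO, haB⟩, haU⟩ := mem_closure_iff.1 hpc _ (hO.inter Metric.isOpen_ball) ⟨hpO, hpB⟩
  obtain ⟨b, ⟨hbO, hbB⟩, hbU⟩ := mem_closure_iff.1 hzc _
    (hO'.inter (Metric.isOpen_ball.preimage F.continuous)) ⟨hzO', hpB⟩
  have h2 : ∀ u ∈ U, F (F u) ∉ U := hit 2 two_pos (by omega)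
  obtain ⟨G, hG, hGx, hGs⟩ := hF.exists_skip (W := U ∩ O) (B := B) (W' := F '' (U ∩ O'))
    (x := x) (a := a) (b := F b) (y := F x)
    (hUo.inter hO) (hUc.inter hOc).isPreconnected
    Metric.isOpen_ball (convex_ball _ _).isPreconnected
    (F.isOpenMap _ (hUo.inter hO'))
    ((hUc.inter hOc').isPreconnected.image _ F.continuous.continuousOn)
    ⟨hxU, hxO⟩ ⟨haU, haO⟩ haB hbB ⟨b, ⟨hbU, hbO⟩, rfl⟩ ⟨x, ⟨hxU, hxO'⟩, rfl⟩
    (fun u hu hu' => hfree u hu.1 hu'.1)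
    (fun u hu hu' => hPQ.ne_of_mem (hB u hu).2.1 (hB _ hu').1 rfl)
    (by
      rintro _ ⟨u, hu, rfl⟩ ⟨v, hv, hv'⟩
      exact hfree u hu.1 (F.injective hv' ▸ hv.1))
    (fun u hu hu' => hON.ne_of_mem hu'.2 (hB u hu).2.2.1 rfl)
    (by
      rintro _ ⟨u, hu, rfl⟩ hu'
      exact h2 u hu.1 hu'.1)
    (by
      rintro _ ⟨u, hu, rfl⟩ hu'
      have := (hB _ hu').2.2.2.1
      rw [F.symm_apply_apply, F.symm_apply_apply] at this
      exact hON'.ne_of_mem hu.2 this rfl)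
  -- The cycle starts at F x and omits x: its last point is F^(n-1) x, so its length is n - 1.
  have horb : ∀ i, i + 2 ≤ n → G^[i] (F x) = F^[i + 1] x := by
    intro i
    induction i with
    | zero => intro; rfl
    | succ i ih =>
      intro hi
      have e : F (F^[i + 1] x) = F^[i + 2] x := (Function.iterate_succ_apply' F (i + 1) x).symm
      rw [Function.iterate_succ_apply', ih (by omega), hGs, e]
      · rw [e]
        exact fun h => hit (i + 2) (by omega) (by omega) x hxU h.1
      · rw [e]
        exact fun h => (hB _ h).2.2.2.2 (i + 2) (Finset.mem_Ico.2 ⟨by omega, by omega⟩) rfl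
      · rintro ⟨u, hu, hu'⟩
        exact hit (i + 1) (by omega) (by omega) x hxU (F.injective hu' ▸ hu.1)
  obtain ⟨m, rfl⟩ : ∃ m, n = m + 2 := ⟨n - 2, by omega⟩
  refine hn (m + 1) (by omega) (by omega) G hG (F x) ?_
  rw [Function.iterate_succ_apply', horb m le_rfl]
  apply hGx
  rw [← Function.iterate_succ_apply' (f := F)]
  exact hx

theorem noPeriod {n : ℕ} (h0 : 0 < n) : NoPeriod n := by
  induction n using Nat.strong_induction_on with
  | _ n ih =>
    intro F hF x hx
    obtain rfl | rfl | hn : n = 1 ∨ n = 2 ∨ 3 ≤ n := by omega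
    · exact hF.ne x hx
    · exact hF.apply_apply_ne x hx
    · exact hF.exists_shorter_period hn (fun k hk hkn => ih k hkn hk) hx

/-! ### Transfer to the real plane -/

/-- The standard isometry between the complex numbers and the plane. -/
noncomputable def complexPlane : ℂ ≃ₗᵢ[ℝ] Plane := Complex.orthonormalBasisOneI.repr

theorem complexPlane_exp (t : ℝ) : complexPlane (Complex.exp (t * Complex.I)) = unitVec t := by
  ext i
  have h := congrFun (Complex.orthonormalBasisOneI_repr_apply (Complex.exp (t * Complex.I))) i
  refine h.trans ?_
  fin_cases i <;> simp [unitVec, Complex.exp_ofReal_mul_I_re, Complex.exp_ofReal_mul_I_im]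

/-- A plane homeomorphism read in the complex coordinate. -/
noncomputable def complexConj (f : Plane ≃ₜ Plane) : ℂ ≃ₜ ℂ :=
  (complexPlane.toHomeomorph.trans f).trans complexPlane.toHomeomorph.symm

theorem complexPlane_complexConj (f : Plane ≃ₜ Plane) (z : ℂ) :
    complexPlane (complexConj f z) = f (complexPlane z) :=
  complexPlane.apply_symm_apply _

theorem IsFreeMapping.isFreeHomeo {f : Plane ≃ₜ Plane} (hf : IsFreeMapping f) :
    IsFreeHomeo (complexConj f) where
  log := by
    obtain ⟨-, φ, hφ, h, h1⟩ := hf.orientationPreserving 0 1 one_pos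
    refine HasLogDisplacement.of_winding (complexConj f).continuous (complexConj f).injective hφ
      (fun t => complexPlane.injective ?_) (by simpa using h1)
    have := h t
    beta_reduce at this
    rw [← complexPlane_exp, ← complexPlane_exp, zero_add, one_smul,
      ← complexPlane_complexConj, ← complexPlane.map_zero, ← complexPlane_complexConj,
      ← map_sub, complexPlane.norm_map, ← complexPlane.map_smul] at this
    rw [this, Complex.real_smul]
  ne z hz := hf.fixedPointFree (complexPlane z) (by rw [← complexPlane_complexConj, hz])

theorem complexPlane_iterate (f : Plane ≃ₜ Plane) (k : ℕ) (z : ℂ) :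
    complexPlane ((complexConj f)^[k] z) = (f ^ k) (complexPlane z) := by
  induction k with
  | zero => rfl
  | succ k ih =>
    rw [Function.iterate_succ_apply', complexPlane_complexConj, ih, pow_succ']
    rfl

/-- A small disc about any point is disjoint from all its forward iterates. -/
theorem IsFreeMapping.exists_nhds_pow_notMem {f : Plane ≃ₜ Plane} (hf : IsFreeMapping f)
    (x : Plane) : ∃ U ∈ 𝓝 x, ∀ k : ℕ, 0 < k → ∀ y ∈ U, (f ^ k) y ∉ U := by
  obtain ⟨r, hr, -, hfree, -⟩ := hf.isFreeHomeo.exists_maximal_free_ball (complexPlane.symm x)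
  refine ⟨complexPlane.symm ⁻¹' Metric.ball (complexPlane.symm x) r,
    complexPlane.symm.continuous.continuousAt (Metric.ball_mem_nhds _ hr), fun k hk y hy hky => ?_⟩
  refine hf.isFreeHomeo.iterate_notMem Metric.isOpen_ball (convex_ball _ _).isPreconnected hfree
    (fun j hj _ => noPeriod hj) k hk (Nat.lt_succ_self k) _ hy ?_
  have := complexPlane_iterate f k (complexPlane.symm y)
  rw [complexPlane.apply_symm_apply] at this
  rwa [Set.mem_preimage, ← this, complexPlane.symm_apply_apply] at hky

theorem mainTheorem8 (f : Plane ≃ₜ Plane) (hf : IsFreeMapping f) :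
    IsCoveringSpaceAction (Subgroup.zpowers f) Plane := by
  refine ⟨fun g => g.1.continuous, fun x => ?_⟩
  obtain ⟨U, hU, hdisj⟩ := hf.exists_nhds_pow_notMem x
  refine ⟨U, hU, ?_⟩
  rintro ⟨_, n, rfl⟩ hg
  rw [Set.disjoint_left]
  rintro _ ⟨y, hy, rfl⟩ hgy
  change (f ^ n) y ∈ U at hgy
  obtain ⟨k, rfl | rfl⟩ := n.eq_nat_or_neg
  · have hk : 0 < k := Nat.pos_of_ne_zero (by rintro rfl; exact hg (Subtype.ext (zpow_zero f)))
    rw [zpow_natCast] at hgy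
    exact hdisj k hk y hy hgy
  · have hk : 0 < k := Nat.pos_of_ne_zero (by
      rintro rfl
      exact hg (Subtype.ext (zpow_zero f)))
    -- For a negative power, the image point lies in U and the forward iterate returns it to y.
    refine hdisj k hk _ hgy ?_
    change (f ^ k * f ^ (-(k : ℤ))) y ∈ U
    rwa [zpow_neg, zpow_natCast, mul_inv_cancel]
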